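/- Let $N, n_0 \ge 1$. Consider the multi-agent system consisting of a leader (exosystem) $\dot v = A_0 v$, $v\in\mathbb{R}^{n_0}$, and $N$ followers $$\dot x_i = A_i x_i + B_i u_i + E_i v,\qquad y_i = C_i x_i + D_i u_i + G_i v,\qquad i=1,\dots,N,$$ with real matrices, $x_i\in\mathbb{R}^{n_i}$, $u_i\in\mathbb{R}^{m_i}$, $y_i\in\mathbb{R}^{p_i}$, and references $-F_i v$, $F_i\in\mathbb{R}^{p_i\times n_0}$. Let $\mathcal{A}=[a_{ij}]\in\mathbb{R}^{N\times N}$ with $a_{ii}=0$ be the adjacency matrix of a signed directed graph on the followers ($(j,i)$ is an edge iff $a_{ij}\neq 0$), let $f_i\ge 0$ be pinning gains, and let $\mathcal{G}(\bar{\mathcal{A}})$ be the augmented graph on $\{0,1,\dots,N\}$ obtained by adding the leader as node $0$ and an edge $(0,i)$ for each $i$ with $f_i>0$ (no edge enters node $0$). Let $S=\mathrm{diag}(s_1,\dots,s_N)$ be a real diagonal matrix with exactly $k$ distinct diagonal entries, $1\le k\le N$ (a $k$-partition transformation). For $\mu\in\mathbb{R}$, $K_{1i}\in\mathbb{R}^{m_i\times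 n_i}$, $K_{2i}\in\mathbb{R}^{m_i\times n_0}$ consider the feedforward distributed-observer control law $$\dot\eta_i = A_0\eta_i+\mu\Big(\sum_{j=1}^N |a_{ij}|(\eta_j-\eta_i)+f_i(v-\eta_i)\Big),\qquad u_i=K_{1i}x_i+K_{2i}\eta_i,\qquad i=1,\dots,N. \tag{8}$$ The multi-partite output regulation problem (MORP) is said to be solvable by the law (8) if $\mu$, $K_{1i}$, $K_{2i}$ can be chosen such that the system matrix of the closed-loop system with state $(x_1,\dots,x_N,\eta_1,\dots,\eta_N)$ is Hurwitz (all its eigenvalues have negative real part) and, for all initial states of the exosystem and of the closed-loop system, every tracking error $e_i = y_i+s_iF_iv$ satisfies $\lim_{t\to\infty}e_i(t)=0$. Consider the following three conditions: (a) for every $i$, the pair $(A_i,B_i)$ is stabilizable, that is, $A_i+B_iK$ is Hurwitz for some real matrix $K$; (b) for every $i$, there are real matrices $X_i$, $U_i$ that satisfy the partition-dependent regulator equations $$X_iA_0=A_iX_i+B_iU_i+E_i,\qquad 0=C_iX_i+D_iU_i+G_i+s_iF_i;$$ (c) the augmented graph $\mathcal{G}(\bar{\mathcal{A}})$ contains a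 directed spanning tree. Then: (i) Suppose that $\mathrm{spec}(A_0)\subsetneq\mathrm{CRHP}$, where $\mathrm{CRHP}=\{z\in\mathbb{C}:\mathrm{Re}\,z\ge 0\}$. If the MORP is solvable by the control law (8), then (a), (b) and (c) hold. (ii) If (a), (b) and (c) hold (with no assumption on $\mathrm{spec}(A_0)$), then the MORP is solvable by the control law (8). -/

import Mathlib

open Matrix Filter Topology
open scoped Kronecker

namespace MORP

/-- The spectrum of a real square matrix: the set of its complex eigenvalues. -/
def spec {ι : Type*} [Fintype ι] [DecidableEq ι] (M : Matrix ι ι ℝ) : Set ℂ :=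
  spectrum ℂ (M.map (algebraMap ℝ ℂ))

/-- The closed right half complex plane. -/
def CRHP : Set ℂ := {z | 0 ≤ z.re}

/-- A real square matrix is Hurwitz if all of its eigenvalues have negative real part. -/
def IsHurwitz {ι : Type*} [Fintype ι] [DecidableEq ι] (M : Matrix ι ι ℝ) : Prop :=
  ∀ z ∈ spec M, z.re < 0

/-- `(A, B)` is stabilizable if some state feedback `K` makes `A + B K` Hurwitz. -/
def IsStabilizable {n m : ℕ} (A : Matrix (Fin n) (Fin n) ℝ) (B : Matrix (Fin n) (Fin m) ℝ) : Prop :=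
  ∃ K : Matrix (Fin m) (Fin n) ℝ, IsHurwitz (A + B * K)

/-- A signed (weighted) directed graph without self-loops, given by its adjacency matrix. -/
structure SignedDigraph (V : Type*) where
  adj : Matrix V V ℝ
  no_loops : ∀ i, adj i i = 0

/-- The edge set: `(j, i)` is an edge if and only if `a_{ij} ≠ 0`. -/
def SignedDigraph.toDigraph {V : Type*} (G : SignedDigraph V) : Digraph V where
  Adj j i := G.adj i j ≠ 0

/-- `T` is a directed tree with root `r`: the root has no parent, every other node has exactly one
parent, and there is a directed path from the root to every node. -/
def IsDirectedTree {V : Type*} (T : Digraph V) (r : V) : Prop :=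
  (∀ j, ¬ T.Adj j r) ∧ (∀ i, i ≠ r → ∃! j, T.Adj j i) ∧ ∀ i, Relation.ReflTransGen T.Adj r i

/-- The graph contains a directed tree on all of its nodes. -/
def SignedDigraph.HasDirectedSpanningTree {V : Type*} (G : SignedDigraph V) : Prop :=
  ∃ (T : Digraph V) (r : V), T ≤ G.toDigraph ∧ IsDirectedTree T r

/-- The information exchange of `N` followers and one leader: a signed directed graph on the
followers, and pinning gains `f i ≥ 0`, with `f i > 0` if and only if follower `i` has access to the
information of the leader. -/
structure AugmentedDigraph (N : ℕ) where
  followers : SignedDigraph (Fin N)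
  f : Fin N → ℝ
  f_nonneg : ∀ i, 0 ≤ f i

namespace AugmentedDigraph

variable {N : ℕ}

/-- The augmented signed directed graph. The node `none` is the leader, the node `some i` is
follower `i`. No edge enters the leader. -/
def augmented (G : AugmentedDigraph N) : SignedDigraph (Option (Fin N)) where
  adj := Matrix.of fun a b =>
    match a, b with
    | none, _ => 0
    | some i, none => G.f i
    | some i, some j => G.followers.adj i j
  no_loops := by
    rintro (_ | i)
    · rfl
    · exact G.followers.no_loops i

/-- The Laplacian of the unsigned graph whose adjacency matrix is the entrywise absolute value. -/
def laplacianU (G : AugmentedDigraph N) : Matrix (Fin N) (Fin N) ℝ :=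
  Matrix.diagonal (fun i => ∑ j, |G.followers.adj i j|) - G.followers.adj.map (fun a => |a|)

/-- `H = L_u + diag (f_1, …, f_N)`. -/
def matH (G : AugmentedDigraph N) : Matrix (Fin N) (Fin N) ℝ :=
  G.laplacianU + Matrix.diagonal G.f

end AugmentedDigraph

/-- `S = diag (s_1, …, s_N)` is a `k`-partition transformation if it has exactly `k` distinct
diagonal entries, `1 ≤ k ≤ N`. -/
def IsPartitionTransformation {N : ℕ} (k : ℕ) (S : Matrix (Fin N) (Fin N) ℝ) : Prop :=
  S.IsDiag ∧ 1 ≤ k ∧ k ≤ N ∧ (Set.range fun i => S i i).ncard = k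

/-- The data of a heterogeneous linear multi-agent system: the exosystem `v' = A₀ v` and the
followers `x_i' = A_i x_i + B_i u_i + E_i v`, `y_i = C_i x_i + D_i u_i + G_i v`, with reference
`-F_i v`. -/
structure MAS (N n₀ : ℕ) (n m p : Fin N → ℕ) where
  A₀ : Matrix (Fin n₀) (Fin n₀) ℝ
  A : ∀ i, Matrix (Fin (n i)) (Fin (n i)) ℝ
  B : ∀ i, Matrix (Fin (n i)) (Fin (m i)) ℝ
  E : ∀ i, Matrix (Fin (n i)) (Fin n₀) ℝ
  C : ∀ i, Matrix (Fin (p i)) (Fin (n i)) ℝ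
  D : ∀ i, Matrix (Fin (p i)) (Fin (m i)) ℝ
  G : ∀ i, Matrix (Fin (p i)) (Fin n₀) ℝ
  F : ∀ i, Matrix (Fin (p i)) (Fin n₀) ℝ

/-- The parameters of the feedforward control law with distributed observer. -/
structure Gains (N n₀ : ℕ) (n m : Fin N → ℕ) where
  μ : ℝ
  K₁ : ∀ i, Matrix (Fin (m i)) (Fin (n i)) ℝ
  K₂ : ∀ i, Matrix (Fin (m i)) (Fin n₀) ℝ

namespace MAS

variable {N n₀ : ℕ} {n m p : Fin N → ℕ}

/-- The control input `u_i = K_{1i} x_i + K_{2i} η_i`, at a given time. -/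
def input (K : Gains N n₀ n m) (i : Fin N) (xi : Fin (n i) → ℝ) (ηi : Fin n₀ → ℝ) :
    Fin (m i) → ℝ :=
  K.K₁ i *ᵥ xi + K.K₂ i *ᵥ ηi

/-- The tracking error `e_i = y_i + s_i F_i v` under the control law, at a given time. -/
def trackingError (P : MAS N n₀ n m p) (S : Matrix (Fin N) (Fin N) ℝ) (K : Gains N n₀ n m)
    (i : Fin N) (v : Fin n₀ → ℝ) (xi : Fin (n i) → ℝ) (ηi : Fin n₀ → ℝ) : Fin (p i) → ℝ :=
  (P.C i *ᵥ xi + P.D i *ᵥ input K i xi ηi + P.G i *ᵥ v) + S i i • (P.F i *ᵥ v)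

/-- `v`, `x`, `η` solve, on the time interval `[0, ∞)`, the exosystem, the follower equations and
the distributed observer
`η_i' = A₀ η_i + μ (∑_j |a_{ij}| (η_j - η_i) + f_i (v - η_i))`. -/
structure IsTrajectory (P : MAS N n₀ n m p) (G : AugmentedDigraph N) (K : Gains N n₀ n m)
    (v : ℝ → Fin n₀ → ℝ) (x : ∀ i, ℝ → Fin (n i) → ℝ) (η : Fin N → ℝ → Fin n₀ → ℝ) : Prop where
  exosystem : ∀ t, 0 ≤ t → HasDerivWithinAt v (P.A₀ *ᵥ v t) (Set.Ici 0) t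
  follower : ∀ i t, 0 ≤ t → HasDerivWithinAt (x i)
    (P.A i *ᵥ x i t + P.B i *ᵥ input K i (x i t) (η i t) + P.E i *ᵥ v t) (Set.Ici 0) t
  observer : ∀ i t, 0 ≤ t → HasDerivWithinAt (η i)
    (P.A₀ *ᵥ η i t + K.μ • ((∑ j, |G.followers.adj i j| • (η j t - η i t))
      + G.f i • (v t - η i t))) (Set.Ici 0) t

/-- The closed-loop system matrix, acting on the stacked state `(x_1, …, x_N, η_1, …, η_N)`. -/
def closedLoopMatrix (P : MAS N n₀ n m p) (G : AugmentedDigraph N) (K : Gains N n₀ n m) :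
    Matrix ((Σ i, Fin (n i)) ⊕ (Fin N × Fin n₀)) ((Σ i, Fin (n i)) ⊕ (Fin N × Fin n₀)) ℝ :=
  Matrix.fromBlocks
    (Matrix.blockDiagonal' fun i => P.A i + P.B i * K.K₁ i)
    (Matrix.of fun a b => if a.1 = b.1 then (P.B a.1 * K.K₂ a.1) a.2 b.2 else 0)
    0
    ((1 : Matrix (Fin N) (Fin N) ℝ) ⊗ₖ P.A₀
      - K.μ • (G.matH ⊗ₖ (1 : Matrix (Fin n₀) (Fin n₀) ℝ)))

/-- The control law with the given gains solves the multi-partite output regulation problem: the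
closed-loop system matrix is Hurwitz, and every tracking error tends to zero, whatever the initial
state of the exosystem and of the closed-loop system. -/
def SolvesMORP (P : MAS N n₀ n m p) (G : AugmentedDigraph N) (S : Matrix (Fin N) (Fin N) ℝ)
    (K : Gains N n₀ n m) : Prop :=
  IsHurwitz (P.closedLoopMatrix G K) ∧
    ∀ (v : ℝ → Fin n₀ → ℝ) (x : ∀ i, ℝ → Fin (n i) → ℝ) (η : Fin N → ℝ → Fin n₀ → ℝ),
      P.IsTrajectory G K v x η →
        ∀ i, Tendsto (fun t => P.trackingError S K i (v t) (x i t) (η i t)) atTop (𝓝 0)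

/-- The multi-partite output regulation problem is solvable by the feedforward control law with
distributed observer. -/
def MORPSolvable (P : MAS N n₀ n m p) (G : AugmentedDigraph N) (S : Matrix (Fin N) (Fin N) ℝ) :
    Prop :=
  ∃ K : Gains N n₀ n m, P.SolvesMORP G S K

/-- Every pair `(A_i, B_i)` is stabilizable. -/
def Stabilizable (P : MAS N n₀ n m p) : Prop :=
  ∀ i, IsStabilizable (P.A i) (P.B i)

/-- For every `i`, the partition-dependent regulator equations have a solution `(X_i, U_i)`. -/
def RegulatorEquationsSolvable (P : MAS N n₀ n m p) (S : Matrix (Fin N) (Fin N) ℝ) : Prop :=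
  ∀ i, ∃ (X : Matrix (Fin (n i)) (Fin n₀) ℝ) (U : Matrix (Fin (m i)) (Fin n₀) ℝ),
    X * P.A₀ = P.A i * X + P.B i * U + P.E i ∧
    0 = P.C i * X + P.D i * U + P.G i + S i i • P.F i

end MAS

end MORP

/-! The closed-loop matrix is block triangular: its spectrum is the union of the spectra of `A i + B
i * K₁ i` and of the differences `a - h` with `a ∈ spec A₀` and `h ∈ spec (μ • H)`, by
`mem_spec_kronecker_sub_iff`.

Necessity: the feedback blocks give stabilizability. If `spec A₀` lies in `CRHP`, a zero eigenvalue
of `H` would leave some `a` in the observer spectrum, so `det H ≠ 0`; a set of followers that the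
leader cannot reach would make `H` singular. A Sylvester equation gives `X` such that `x = X v`, `η
= v` is a trajectory. Its error is a constant matrix times `v`; as no mode of `v` decays, this
matrix vanishes, which is the second regulator equation.

Sufficiency: if the leader reaches every follower, `spec H` lies in the open right half plane, so a
large `μ` stabilizes the observer. With `K₂ = U - K₁ X`, first `η - v` and then `x - X v` decay, and
the error is a linear combination of the two. -/

namespace MORP

/-! ### Eigenvalues, eigenvectors and block triangular matrices -/

section Spectrum

variable {ι : Type*} [Fintype ι] [DecidableEq ι]

theorem mem_spec_iff_det_eq_zero {M : Matrix ι ι ℝ} {z : ℂ} :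
    z ∈ spec M ↔ (z • (1 : Matrix ι ι ℂ) - M.map (algebraMap ℝ ℂ)).det = 0 := by
  rw [spec, spectrum.mem_iff, Matrix.isUnit_iff_isUnit_det, isUnit_iff_ne_zero, not_not,
    Algebra.algebraMap_eq_smul_one]

theorem mem_spec_iff_exists_mulVec {M : Matrix ι ι ℝ} {z : ℂ} :
    z ∈ spec M ↔ ∃ w : ι → ℂ, w ≠ 0 ∧ M.map (algebraMap ℝ ℂ) *ᵥ w = z • w := by
  rw [mem_spec_iff_det_eq_zero, ← Matrix.exists_mulVec_eq_zero_iff]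
  refine exists_congr fun w => and_congr_right fun _ => ?_
  rw [Matrix.sub_mulVec, sub_eq_zero, Matrix.smul_mulVec, Matrix.one_mulVec, eq_comm]

theorem mem_spec_iff_exists_vecMul {M : Matrix ι ι ℝ} {z : ℂ} :
    z ∈ spec M ↔ ∃ w : ι → ℂ, w ≠ 0 ∧ w ᵥ* M.map (algebraMap ℝ ℂ) = z • w := by
  rw [mem_spec_iff_det_eq_zero, ← Matrix.exists_vecMul_eq_zero_iff]
  refine exists_congr fun w => and_congr_right fun _ => ?_
  rw [Matrix.vecMul_sub, sub_eq_zero, Matrix.vecMul_smul, Matrix.vecMul_one, eq_comm]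

theorem mem_spec_of_mem_roots_charpoly {M : Matrix ι ι ℝ} {z : ℂ}
    (hz : z ∈ (M.map (algebraMap ℝ ℂ)).charpoly.roots) : z ∈ spec M := by
  rw [mem_spec_iff_det_eq_zero, Matrix.smul_one_eq_diagonal, ← Matrix.scalar_apply,
    ← Matrix.eval_charpoly]
  exact Polynomial.isRoot_of_mem_roots hz

theorem spec_nonempty [Nonempty ι] (M : Matrix ι ι ℝ) : (spec M).Nonempty :=
  spectrum.nonempty_of_isAlgClosed_of_finiteDimensional ℂ _

theorem spec_fromBlocks_zero₂₁ {κ : Type*} [Fintype κ] [DecidableEq κ] (A : Matrix ι ι ℝ)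
    (B : Matrix ι κ ℝ) (D : Matrix κ κ ℝ) :
    spec (Matrix.fromBlocks A B 0 D) = spec A ∪ spec D := by
  ext z
  rw [Set.mem_union, mem_spec_iff_det_eq_zero, mem_spec_iff_det_eq_zero, mem_spec_iff_det_eq_zero,
    ← mul_eq_zero, ← Matrix.det_fromBlocks_zero₂₁ _ (-B.map (algebraMap ℝ ℂ)),
    ← Matrix.fromBlocks_one, Matrix.fromBlocks_smul, Matrix.fromBlocks_map,
    sub_eq_add_neg (Matrix.fromBlocks _ _ _ _), Matrix.fromBlocks_neg, Matrix.fromBlocks_add]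
  simp [sub_eq_add_neg]

end Spectrum

/-- Serves to isolate one mode among decaying functionals, and to find joint eigenvectors of
commuting matrices. -/
theorem exists_eigenvector_mem {V : Type*} [AddCommGroup V] [Module ℂ V] [FiniteDimensional ℂ V]
    (f : Module.End ℂ V) (p : Submodule ℂ V) (hp : p ≠ ⊥) (hf : ∀ x ∈ p, f x ∈ p) :
    ∃ x ∈ p, x ≠ 0 ∧ ∃ a : ℂ, f x = a • x := by
  have : Nontrivial p := (Submodule.nontrivial_iff_ne_bot).2 hp
  obtain ⟨a, ha⟩ := Module.End.exists_eigenvalue (f.restrict hf)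
  obtain ⟨x, hx⟩ := ha.exists_hasEigenvector
  refine ⟨x, x.2, fun h => hx.2 (Subtype.ext h), a, ?_⟩
  simpa using congrArg Subtype.val hx.apply_eq_smul

/-! ### Decay of linear systems and the Sylvester equation -/

section Stability

/-- The integrating factor `exp (-a t)` turns the equation into `(exp (-a t) y)' = exp (-a t) g`,
whose right side is eventually small relative to `exp (r t)`. -/
theorem tendsto_zero_of_hasDerivWithinAt {y g : ℝ → ℂ} {a : ℂ} (ha : a.re < 0)
    (hy : ∀ t, 0 ≤ t → HasDerivWithinAt y (a * y t + g t) (Set.Ici 0) t)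
    (hg : Tendsto g atTop (𝓝 0)) : Tendsto y atTop (𝓝 0) := by
  obtain ⟨r, hr, hre⟩ : ∃ r : ℝ, 0 < r ∧ a.re = -r := ⟨-a.re, by linarith, by ring⟩
  rw [Metric.tendsto_atTop]
  intro ε hε
  -- The factor `r` cancels when `exp (r t)` is integrated, which leaves `ε / 2`; the other half
  -- absorbs the initial value.
  obtain ⟨T₀, hT₀⟩ := Metric.tendsto_atTop.1 hg (r * (ε / 2)) (by positivity)
  set T := max T₀ 0
  have hT : 0 ≤ T := le_max_right _ _
  have hnexp (t : ℝ) : ‖Complex.exp (-a * t)‖ = Real.exp (r * t) := by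
    rw [Complex.norm_exp]; simp [hre]
  have hder (t : ℝ) (ht : T ≤ t) : HasDerivWithinAt (fun t : ℝ => Complex.exp (-a * t) * y t)
      (Complex.exp (-a * t) * g t) (Set.Ici 0) t := by
    have h1 : HasDerivAt (fun t : ℝ => Complex.exp (-a * t)) (Complex.exp (-a * t) * (-a)) t := by
      have := ((Complex.ofRealCLM.hasDerivAt (x := t)).const_mul (-a)).cexp
      simpa using this
    refine (h1.hasDerivWithinAt.mul (hy t (hT.trans ht))).congr_deriv ?_
    ring
  have hB (t : ℝ) : HasDerivAt
      (fun t => ‖Complex.exp (-a * T) * y T‖ + ε / 2 * (Real.exp (r * t) - Real.exp (r * T)))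
      (Real.exp (r * t) * (r * (ε / 2))) t := by
    have h1 : HasDerivAt (fun t : ℝ => Real.exp (r * t)) (Real.exp (r * t) * r) t := by
      simpa using ((hasDerivAt_id t).const_mul r).exp
    refine (((h1.sub_const _).const_mul (ε / 2)).const_add _).congr_deriv ?_
    ring
  have key (t : ℝ) (ht : T ≤ t) : ‖Complex.exp (-a * t) * y t‖ ≤
      ‖Complex.exp (-a * T) * y T‖ + ε / 2 * (Real.exp (r * t) - Real.exp (r * T)) := by
    refine image_norm_le_of_norm_deriv_right_le_deriv_boundary (a := T) (b := t)
      (f := fun t : ℝ => Complex.exp (-a * t) * y t)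
      (f' := fun t : ℝ => Complex.exp (-a * t) * g t) ?_ ?_ ?_ hB ?_ ⟨ht, le_rfl⟩
    · exact fun s hs => (hder s hs.1).continuousWithinAt.mono fun u hu => hT.trans hu.1
    · exact fun s hs => (hder s hs.1).mono fun u hu => (hT.trans hs.1).trans hu
    · simp
    · intro s hs
      rw [norm_mul, hnexp]
      have := hT₀ s ((le_max_left _ _).trans hs.1)
      rw [dist_zero_right] at this
      gcongr
  have hlim : Tendsto (fun t => ‖Complex.exp (-a * T) * y T‖ * Real.exp (-(r * t))) atTop (𝓝 0) := by
    have := (Real.tendsto_exp_neg_atTop_nhds_zero.comp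
      (tendsto_id.const_mul_atTop hr)).const_mul ‖Complex.exp (-a * T) * y T‖
    simpa using this
  obtain ⟨T₁, hT₁⟩ := Metric.tendsto_atTop.1 hlim (ε / 2) (by positivity)
  refine ⟨max T T₁, fun t ht => ?_⟩
  have h1 := key t ((le_max_left _ _).trans ht)
  have h2 := hT₁ t ((le_max_right _ _).trans ht)
  rw [dist_zero_right] at h2 ⊢
  have h2 := (le_abs_self _).trans_lt h2
  rw [norm_mul, hnexp] at h1
  have he : Real.exp (r * t) * Real.exp (-(r * t)) = 1 := by rw [← Real.exp_add]; simp
  have hp := Real.exp_pos (-(r * t))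
  have hpT := Real.exp_pos (r * T)
  calc ‖y t‖ = Real.exp (-(r * t)) * (Real.exp (r * t) * ‖y t‖) := by
        rw [← mul_assoc, mul_comm (Real.exp (-(r * t))), he, one_mul]
    _ ≤ Real.exp (-(r * t)) * (‖Complex.exp (-a * T) * y T‖ + ε / 2 * Real.exp (r * t)) := by
        gcongr
        refine h1.trans ?_
        gcongr
        linarith
    _ = ‖Complex.exp (-a * T) * y T‖ * Real.exp (-(r * t))
          + ε / 2 * (Real.exp (r * t) * Real.exp (-(r * t))) := by ring
    _ < ε := by rw [he]; linarith

variable {ι : Type*} [Fintype ι]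

theorem hasDerivWithinAt_dotProduct_ofReal {ζ : ℝ → ι → ℝ} {ζ' : ι → ℝ} {s : Set ℝ} {t : ℝ}
    (h : HasDerivWithinAt ζ ζ' s t) (c : ι → ℂ) :
    HasDerivWithinAt (fun t => c ⬝ᵥ fun i => (ζ t i : ℂ)) (c ⬝ᵥ fun i => (ζ' i : ℂ)) s t := by
  simp only [dotProduct]
  refine HasDerivWithinAt.fun_sum fun i _ => HasDerivWithinAt.const_mul _ ?_
  exact (Complex.ofRealCLM.hasFDerivAt.comp_hasDerivWithinAt t (hasDerivWithinAt_pi.1 h i))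

theorem tendsto_dotProduct_ofReal {ζ : ℝ → ι → ℝ} (h : Tendsto ζ atTop (𝓝 0)) (c : ι → ℂ) :
    Tendsto (fun t => c ⬝ᵥ fun i => (ζ t i : ℂ)) atTop (𝓝 0) := by
  have : Continuous fun x : ι → ℝ => c ⬝ᵥ fun i => (x i : ℂ) := by
    simp only [dotProduct]
    fun_prop
  simpa [dotProduct, Function.comp_def] using (this.tendsto 0).comp h

theorem dotProduct_ofReal_mulVec (c : ι → ℂ) (M : Matrix ι ι ℝ) (x : ι → ℝ) :
    (c ⬝ᵥ fun i => ((M *ᵥ x) i : ℂ)) =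
      (c ᵥ* M.map (algebraMap ℝ ℂ)) ⬝ᵥ fun i => (x i : ℂ) := by
  rw [← Matrix.dotProduct_mulVec]
  congr 1
  ext i
  simp [Matrix.mulVec, dotProduct]

theorem hasDerivAt_mulVec {κ : Type*} [Fintype κ] (M : Matrix κ ι ℝ) {v : ℝ → ι → ℝ} {v' : ι → ℝ}
    {t : ℝ} (h : HasDerivAt v v' t) : HasDerivAt (fun t => M *ᵥ v t) (M *ᵥ v') t :=
  (LinearMap.toContinuousLinearMap M.mulVecLin).hasFDerivAt.comp_hasDerivAt t h

variable [DecidableEq ι]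

/-- A stable linear system driven by an input that tends to zero has a state that tends to zero. -/
theorem IsHurwitz.tendsto_zero {M : Matrix ι ι ℝ} (hM : IsHurwitz M) {ζ g : ℝ → ι → ℝ}
    (hζ : ∀ t, 0 ≤ t → HasDerivWithinAt ζ (M *ᵥ ζ t + g t) (Set.Ici 0) t)
    (hg : Tendsto g atTop (𝓝 0)) : Tendsto ζ atTop (𝓝 0) := by
  set Mc := M.map (algebraMap ℝ ℂ) with hMc
  -- The scalar `y = c ⬝ᵥ ζ` satisfies `y' = a y + c (M - a) ζ + c g`, with a forcing term that
  -- tends to zero.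
  have step (a : ℂ) (ha : a.re < 0) (c : ι → ℂ)
      (hc : Tendsto (fun t => (c ᵥ* (Mc - algebraMap ℂ _ a)) ⬝ᵥ fun i => (ζ t i : ℂ)) atTop (𝓝 0)) :
      Tendsto (fun t => c ⬝ᵥ fun i => (ζ t i : ℂ)) atTop (𝓝 0) := by
    refine tendsto_zero_of_hasDerivWithinAt ha (g := fun t =>
      ((c ᵥ* (Mc - algebraMap ℂ _ a)) ⬝ᵥ fun i => (ζ t i : ℂ)) + c ⬝ᵥ fun i => (g t i : ℂ))
      (fun t ht => ?_) (by simpa using hc.add (tendsto_dotProduct_ofReal hg c))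
    refine (hasDerivWithinAt_dotProduct_ofReal (hζ t ht) c).congr_deriv ?_
    have : (fun i => ((M *ᵥ ζ t + g t) i : ℂ)) =
        (fun i => ((M *ᵥ ζ t) i : ℂ)) + fun i => (g t i : ℂ) := by ext; simp
    rw [this, dotProduct_add, dotProduct_ofReal_mulVec, Matrix.vecMul_sub, sub_dotProduct,
      Algebra.algebraMap_eq_smul_one, Matrix.vecMul_smul, Matrix.vecMul_one, smul_dotProduct,
      smul_eq_mul]
    ring
  have peel (s : Multiset ℂ) (hs : ∀ a ∈ s, a.re < 0) (c : ι → ℂ)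
      (hc : Tendsto (fun t => (c ᵥ* Polynomial.aeval Mc
        (s.map fun a => Polynomial.X - Polynomial.C a).prod) ⬝ᵥ fun i => (ζ t i : ℂ))
        atTop (𝓝 0)) :
      Tendsto (fun t => c ⬝ᵥ fun i => (ζ t i : ℂ)) atTop (𝓝 0) := by
    induction s using Multiset.induction_on with
    | empty => simpa using hc
    | cons a s ih =>
      refine ih (fun b hb => hs b (Multiset.mem_cons_of_mem hb))
        (step a (hs a (Multiset.mem_cons_self a s)) _ ?_)
      rw [Multiset.map_cons, Multiset.prod_cons, mul_comm, map_mul, ← Matrix.vecMul_vecMul] at hc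
      simpa using hc
  have all (c : ι → ℂ) : Tendsto (fun t => c ⬝ᵥ fun i => (ζ t i : ℂ)) atTop (𝓝 0) := by
    -- By Cayley–Hamilton the product of all factors `Mc - a` is zero, so peeling them off one by
    -- one starts from the zero function; no Jordan form is needed.
    refine peel Mc.charpoly.roots (fun a ha => hM a (mem_spec_of_mem_roots_charpoly ha)) c ?_
    rw [← (IsAlgClosed.splits Mc.charpoly).eq_prod_roots_of_monic (Matrix.charpoly_monic Mc),
      Matrix.aeval_self_charpoly]
    simp
  rw [tendsto_pi_nhds]
  intro i
  have h := (Complex.continuous_re.tendsto 0).comp (all (Pi.single i 1))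
  simpa [Function.comp_def] using h

theorem exists_solution (A : Matrix ι ι ℝ) (v₀ : ι → ℝ) :
    ∃ v : ℝ → ι → ℝ, v 0 = v₀ ∧ ∀ t, HasDerivAt v (A *ᵥ v t) t := by
  let _ : NormedRing (Matrix ι ι ℝ) := Matrix.linftyOpNormedRing
  let _ : NormedAlgebra ℝ (Matrix ι ι ℝ) := Matrix.linftyOpNormedAlgebra
  refine ⟨fun t => NormedSpace.exp (t • A) *ᵥ v₀, by simp, fun t => ?_⟩
  have h := hasDerivAt_exp_smul_const' (𝕂 := ℝ) A t
  have := (LinearMap.toContinuousLinearMap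
    ((Matrix.mulVecBilin ℝ ℝ).flip v₀ : Matrix ι ι ℝ →ₗ[ℝ] ι → ℝ)).hasFDerivAt.comp_hasDerivAt t h
  rw [Matrix.mulVec_mulVec]
  exact this

/-- If no mode of `v' = A v` decays, then an output `M v` that always decays is zero. -/
theorem eq_zero_of_tendsto_mulVec {κ : Type*} [Fintype κ] {A : Matrix ι ι ℝ}
    (hA : spec A ⊆ CRHP) {M : Matrix κ ι ℝ}
    (h : ∀ v : ℝ → ι → ℝ, (∀ t, HasDerivAt v (A *ᵥ v t) t) →
      Tendsto (fun t => M *ᵥ v t) atTop (𝓝 0)) : M = 0 := by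
  -- The functionals that decay along every solution. This space is invariant under `c ↦ c A`, since
  -- `A v` is again a solution; if nonzero, it contains a left eigenvector of `A`.
  let R : Submodule ℂ (ι → ℂ) :=
    { carrier := {c | ∀ v : ℝ → ι → ℝ, (∀ t, HasDerivAt v (A *ᵥ v t) t) →
        Tendsto (fun t => c ⬝ᵥ fun i => (v t i : ℂ)) atTop (𝓝 0)}
      add_mem' := fun {c d} hc hd v hv => by
        simpa [add_dotProduct] using (hc v hv).add (hd v hv)
      zero_mem' := fun v hv => by simp
      smul_mem' := fun a c hc v hv => by
        simpa [smul_dotProduct] using (hc v hv).const_mul a }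
  have hR : R = ⊥ := by
    by_contra hne
    obtain ⟨c, hc, hc0, a, ha⟩ := exists_eigenvector_mem
      (A.map (algebraMap ℝ ℂ)).vecMulLinear R hne fun c hc v hv => by
        have := hc (fun t => A *ᵥ v t) fun t => hasDerivAt_mulVec A (hv t)
        simp only [dotProduct_ofReal_mulVec] at this
        exact this
    rw [Matrix.vecMulLinear_apply] at ha
    have hre : 0 ≤ a.re := hA (mem_spec_iff_exists_vecMul.2 ⟨c, hc0, ha⟩)
    obtain ⟨j, hj⟩ := Function.ne_iff.1 hc0
    -- Along this solution `c ⬝ᵥ v` equals `exp (a t) * c j`, of modulus at least `‖c j‖ > 0` for `t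
    -- ≥ 0`, so it cannot decay.
    obtain ⟨v, hv0, hv⟩ := exists_solution A (Pi.single j 1)
    have hlim := hc v hv
    set y : ℝ → ℂ := fun t => c ⬝ᵥ fun i => (v t i : ℂ) with hy
    have hy' (t : ℝ) : HasDerivAt y (a * y t) t := by
      have := hasDerivWithinAt_dotProduct_ofReal (hv t).hasDerivWithinAt (s := Set.univ) c
      rw [dotProduct_ofReal_mulVec, ha, smul_dotProduct, smul_eq_mul, hasDerivWithinAt_univ] at this
      exact this
    have hy0 : y 0 = c j := by
      simp [hy, hv0, dotProduct, Pi.single_apply, apply_ite Complex.ofReal]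
    have hconst (t : ℝ) : Complex.exp (-a * t) * y t = c j := by
      have hd (t : ℝ) : HasDerivAt (fun t : ℝ => Complex.exp (-a * t) * y t) 0 t := by
        have h1 : HasDerivAt (fun t : ℝ => Complex.exp (-a * t)) (Complex.exp (-a * t) * (-a)) t := by
          have := ((Complex.ofRealCLM.hasDerivAt (x := t)).const_mul (-a)).cexp
          simpa using this
        refine (h1.mul (hy' t)).congr_deriv ?_
        ring
      have := is_const_of_deriv_eq_zero (fun t => (hd t).differentiableAt)
        (fun t => (hd t).deriv) t 0
      simpa [hy0] using this
    refine hj (norm_eq_zero.1 (le_antisymm ?_ (norm_nonneg _)))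
    refine ge_of_tendsto hlim.norm ?_ |>.trans_eq norm_zero
    filter_upwards [eventually_ge_atTop 0] with t ht
    rw [← hconst t, norm_mul, Complex.norm_exp]
    refine mul_le_of_le_one_left (norm_nonneg _) (Real.exp_le_one_iff.2 ?_)
    simpa using mul_nonneg hre ht
  ext k i
  have hk : (fun i => (M k i : ℂ)) ∈ R := fun v hv => by
    have := (Complex.continuous_ofReal.tendsto 0).comp (tendsto_pi_nhds.1 (h v hv) k)
    simpa [Function.comp_def, Matrix.mulVec, dotProduct] using this
  rw [hR, Submodule.mem_bot] at hk
  simpa using congrFun hk i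

/-- The Sylvester equation `X A = M X + R` is solvable if `M` is Hurwitz and no mode of `A`
decays. -/
theorem exists_sylvester {κ : Type*} [Fintype κ] [DecidableEq κ] {A : Matrix ι ι ℝ}
    (hA : spec A ⊆ CRHP) {M : Matrix κ κ ℝ} (hM : IsHurwitz M) (R : Matrix κ ι ℝ) :
    ∃ X : Matrix κ ι ℝ, X * A = M * X + R := by
  let L : Matrix κ ι ℝ →ₗ[ℝ] Matrix κ ι ℝ :=
    { toFun := fun X => X * A - M * X
      map_add' := fun X Y => by rw [Matrix.add_mul, Matrix.mul_add]; abel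
      map_smul' := fun a X => by simp [smul_sub] }
  -- If `X A = M X`, then `X v` solves the stable system of `M` and decays for every solution `v`,
  -- hence `X = 0`.
  have hL : Function.Injective L := by
    refine (injective_iff_map_eq_zero L).2 fun X hX => ?_
    refine eq_zero_of_tendsto_mulVec hA fun v hv => ?_
    refine hM.tendsto_zero (g := 0) (fun t _ => ?_) tendsto_const_nhds
    refine (hasDerivAt_mulVec X (hv t)).hasDerivWithinAt.congr_deriv ?_
    have hX : X * A = M * X := sub_eq_zero.1 hX
    simp [Matrix.mulVec_mulVec, hX]
  obtain ⟨X, hX⟩ := (LinearMap.injective_iff_surjective.1 hL) R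
  exact ⟨X, by rw [← hX]; simp [L]⟩

end Stability

end MORP

namespace MORP

/-! ### Spectra of block diagonal matrices and Kronecker sums -/

section Spectrum

variable {ι κ : Type*} [Fintype ι] [DecidableEq ι] [Fintype κ] [DecidableEq κ]

theorem spec_finite (M : Matrix ι ι ℝ) : (spec M).Finite :=
  Matrix.finite_spectrum _

theorem spec_blockDiagonal' {n : ι → ℕ} (M : ∀ i, Matrix (Fin (n i)) (Fin (n i)) ℝ) :
    spec (Matrix.blockDiagonal' M) = ⋃ i, spec (M i) := by
  have hslice (w : (Σ i, Fin (n i)) → ℂ) (i : ι) (k : Fin (n i)) :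
      ((Matrix.blockDiagonal' M).map (algebraMap ℝ ℂ) *ᵥ w) ⟨i, k⟩ =
        ((M i).map (algebraMap ℝ ℂ) *ᵥ fun l => w ⟨i, l⟩) k := by
    simp only [Matrix.mulVec, dotProduct, Fintype.sum_sigma, Matrix.map_apply]
    rw [Finset.sum_eq_single i]
    · simp
    · intro j _ hj
      simp [Matrix.blockDiagonal'_apply_ne _ _ _ hj.symm]
    · simp
  ext z
  rw [Set.mem_iUnion, mem_spec_iff_exists_mulVec]
  constructor
  · rintro ⟨w, hw0, hw⟩
    obtain ⟨⟨i, k⟩, hik⟩ := Function.ne_iff.1 hw0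
    refine ⟨i, mem_spec_iff_exists_mulVec.2 ⟨fun l => w ⟨i, l⟩, Function.ne_iff.2 ⟨k, hik⟩, ?_⟩⟩
    ext l
    rw [← hslice, hw]
    rfl
  · rintro ⟨i, hi⟩
    obtain ⟨u, hu0, hu⟩ := mem_spec_iff_exists_mulVec.1 hi
    obtain ⟨k, hk⟩ := Function.ne_iff.1 hu0
    let U : ∀ j, Fin (n j) → ℂ := Function.update 0 i u
    have hU : ∀ j, (M j).map (algebraMap ℝ ℂ) *ᵥ U j = z • U j := by
      intro j
      by_cases hj : j = i
      · subst hj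
        simpa [U] using hu
      · simp [U, Function.update_of_ne hj]
    refine ⟨fun q => U q.1 q.2, Function.ne_iff.2 ⟨⟨i, k⟩, by simpa [U] using hk⟩, ?_⟩
    ext ⟨j, l⟩
    rw [hslice, hU]
    rfl

omit [DecidableEq κ] in
theorem one_kronecker_mulVec_apply {R : Type*} [CommRing R] (A : Matrix κ κ R) (w : ι × κ → R)
    (i : ι) (k : κ) :
    (((1 : Matrix ι ι R) ⊗ₖ A) *ᵥ w) (i, k) = (A *ᵥ fun l => w (i, l)) k := by
  simp [Matrix.mulVec, dotProduct, Fintype.sum_prod_type, Matrix.one_apply, ite_mul]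

omit [DecidableEq ι] in
theorem kronecker_one_mulVec_apply {R : Type*} [CommRing R] (H : Matrix ι ι R) (w : ι × κ → R)
    (i : ι) (k : κ) :
    ((H ⊗ₖ (1 : Matrix κ κ R)) *ᵥ w) (i, k) = (H *ᵥ fun j => w (j, k)) i := by
  simp [Matrix.mulVec, dotProduct, Fintype.sum_prod_type, Matrix.one_apply, mul_ite, ite_mul]

/-- The matrix commutes with `1 ⊗ A`, so each of its eigenspaces contains a joint eigenvector, whose
nonzero slices are eigenvectors of `A` and `H`. Conversely, tensor products of eigenvectors are
eigenvectors. -/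
theorem mem_spec_kronecker_sub_iff {H : Matrix ι ι ℝ} {A : Matrix κ κ ℝ} {z : ℂ} :
    z ∈ spec ((1 : Matrix ι ι ℝ) ⊗ₖ A - H ⊗ₖ (1 : Matrix κ κ ℝ)) ↔
      ∃ a ∈ spec A, ∃ h ∈ spec H, z = a - h := by
  set Ac := A.map (algebraMap ℝ ℂ)
  set Hc := H.map (algebraMap ℝ ℂ)
  have hmap : ((1 : Matrix ι ι ℝ) ⊗ₖ A - H ⊗ₖ (1 : Matrix κ κ ℝ)).map (algebraMap ℝ ℂ) =
      (1 : Matrix ι ι ℂ) ⊗ₖ Ac - Hc ⊗ₖ (1 : Matrix κ κ ℂ) := by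
    ext ⟨i, k⟩ ⟨j, l⟩
    simp [Ac, Hc, Matrix.one_apply, apply_ite Complex.ofReal]
  rw [mem_spec_iff_exists_mulVec, hmap]
  constructor
  · rintro ⟨w, hw0, hw⟩
    have hcomm : Commute ((1 : Matrix ι ι ℂ) ⊗ₖ Ac)
        ((1 : Matrix ι ι ℂ) ⊗ₖ Ac - Hc ⊗ₖ (1 : Matrix κ κ ℂ)) := by
      refine (Commute.refl _).sub_right ?_
      rw [commute_iff_eq, ← Matrix.mul_kronecker_mul, ← Matrix.mul_kronecker_mul]
      simp
    obtain ⟨u, hu, hu0, a, hua⟩ := exists_eigenvector_mem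
      ((1 : Matrix ι ι ℂ) ⊗ₖ Ac).mulVecLin (Module.End.eigenspace
        ((1 : Matrix ι ι ℂ) ⊗ₖ Ac - Hc ⊗ₖ (1 : Matrix κ κ ℂ)).mulVecLin z)
      (Submodule.ne_bot_iff _ |>.2 ⟨w, Module.End.mem_eigenspace_iff.2 hw, hw0⟩) (fun x hx => by
        rw [Module.End.mem_eigenspace_iff, Matrix.mulVecLin_apply] at hx ⊢
        rw [Matrix.mulVecLin_apply, Matrix.mulVec_mulVec, ← hcomm.eq, ← Matrix.mulVec_mulVec, hx,
          Matrix.mulVec_smul])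
    rw [Module.End.mem_eigenspace_iff, Matrix.mulVecLin_apply, Matrix.sub_mulVec] at hu
    rw [Matrix.mulVecLin_apply] at hua
    have huh : (Hc ⊗ₖ (1 : Matrix κ κ ℂ)) *ᵥ u = (a - z) • u := by
      rw [sub_smul, ← hu, ← hua]; abel
    obtain ⟨⟨i, k⟩, hik⟩ := Function.ne_iff.1 hu0
    refine ⟨a, mem_spec_iff_exists_mulVec.2 ⟨fun l => u (i, l), Function.ne_iff.2 ⟨k, hik⟩, ?_⟩,
      a - z, mem_spec_iff_exists_mulVec.2 ⟨fun j => u (j, k), Function.ne_iff.2 ⟨i, hik⟩, ?_⟩,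
      by ring⟩
    · ext l
      rw [← one_kronecker_mulVec_apply, hua]
      rfl
    · ext j
      rw [← kronecker_one_mulVec_apply, huh]
      rfl
  · rintro ⟨a, ha, h, hh, rfl⟩
    obtain ⟨u, hu0, hu⟩ := mem_spec_iff_exists_mulVec.1 ha
    obtain ⟨w, hw0, hw⟩ := mem_spec_iff_exists_mulVec.1 hh
    obtain ⟨k, hk⟩ := Function.ne_iff.1 hu0
    obtain ⟨i, hi⟩ := Function.ne_iff.1 hw0
    refine ⟨fun q => w q.1 * u q.2, Function.ne_iff.2 ⟨(i, k), mul_ne_zero hi hk⟩, ?_⟩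
    ext ⟨j, l⟩
    rw [Matrix.sub_mulVec, Pi.sub_apply, one_kronecker_mulVec_apply, kronecker_one_mulVec_apply]
    have h1 : (Ac *ᵥ fun l => w j * u l) = w j • (a • u) := by
      rw [← hu, ← Matrix.mulVec_smul]; rfl
    have h2 : (Hc *ᵥ fun j => w j * u l) = u l • (h • w) := by
      rw [← hw, ← Matrix.mulVec_smul]
      congr 1
      ext; simp [mul_comm]
    simp only [h1, h2, Pi.smul_apply, smul_eq_mul]
    ring

end Spectrum

/-! ### Reachability and directed spanning trees -/

section SpanningTree

variable {V : Type*}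

/-- `v` can be reached from `r` along a directed walk with `n` edges. -/
inductive ReachableIn (T : Digraph V) (r : V) : ℕ → V → Prop
  | zero : ReachableIn T r 0 r
  | succ {n : ℕ} {a b : V} : ReachableIn T r n a → T.Adj a b → ReachableIn T r (n + 1) b

theorem exists_reachableIn {T : Digraph V} {r v : V} (h : Relation.ReflTransGen T.Adj r v) :
    ∃ n, ReachableIn T r n v := by
  induction h with
  | refl => exact ⟨0, .zero⟩
  | tail _ hab ih =>
    obtain ⟨n, hn⟩ := ih
    exact ⟨n + 1, hn.succ hab⟩

/-- If every node can be reached from `r`, then the shortest walks form a directed spanning tree. -/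
theorem SignedDigraph.hasDirectedSpanningTree_of_reachable {G : SignedDigraph V} {r : V}
    (h : ∀ v, Relation.ReflTransGen G.toDigraph.Adj r v) : G.HasDirectedSpanningTree := by
  classical
  have hex v := exists_reachableIn (h v)
  let d : V → ℕ := fun v => Nat.find (hex v)
  -- The parent is the last node but one on a shortest walk. It is strictly closer to `r`, so
  -- following parents ends at `r`.
  have hpar (v : V) : ∃ a, v ≠ r → G.toDigraph.Adj a v ∧ d a < d v := by
    by_cases hv : v = r
    · exact ⟨r, fun h => (h hv).elim⟩
    have hd := Nat.find_spec (hex v)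
    generalize hm : Nat.find (hex v) = m at hd
    cases hd with
    | zero => exact (hv rfl).elim
    | @succ n a _ ha hav =>
      refine ⟨a, fun _ => ⟨hav, ?_⟩⟩
      change Nat.find (hex a) < Nat.find (hex v)
      rw [hm]
      exact Nat.lt_succ_of_le (Nat.find_min' (hex a) ha)
  choose par hadj using hpar
  refine ⟨⟨fun j i => i ≠ r ∧ j = par i⟩, r, ?_, ?_, ?_, ?_⟩
  · rintro j i ⟨hi, rfl⟩
    exact (hadj i hi).1
  · exact fun j hj => hj.1 rfl
  · exact fun i hi => ⟨par i, ⟨hi, rfl⟩, fun j hj => hj.2⟩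
  · intro i
    induction hn : d i using Nat.strong_induction_on generalizing i with
    | _ n ih =>
      by_cases hi : i = r
      · rw [hi]
      · exact (ih _ (hn ▸ (hadj i hi).2) (par i) rfl).tail ⟨hi, rfl⟩

end SpanningTree

/-! ### The matrix `H` and reachability from the leader -/

namespace AugmentedDigraph

variable {N : ℕ} (G : AugmentedDigraph N)

/-- No edge enters the leader, so the root of the tree must be the leader. -/
theorem reachable_of_hasDirectedSpanningTree (h : G.augmented.HasDirectedSpanningTree)
    (a : Option (Fin N)) : Relation.ReflTransGen G.augmented.toDigraph.Adj none a := by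
  obtain ⟨T, r, hT, -, hpar, hreach⟩ := h
  have hr : r = none := by
    by_contra hne
    obtain ⟨j, hj, -⟩ := hpar none (Ne.symm hne)
    exact hT hj rfl
  subst hr
  exact Relation.ReflTransGen.mono (fun _ _ h => hT h) _ _ (hreach a)

theorem matH_apply (i j : Fin N) : G.matH i j =
    (if i = j then (∑ l, |G.followers.adj i l|) + G.f i else 0) - |G.followers.adj i j| := by
  simp only [matH, laplacianU, Matrix.add_apply, Matrix.sub_apply, Matrix.diagonal_apply,
    Matrix.map_apply]
  split_ifs <;> ring

theorem matH_mulVec_apply (w : Fin N → ℝ) (i : Fin N) :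
    (G.matH *ᵥ w) i = G.f i * w i - ∑ j, |G.followers.adj i j| * (w j - w i) := by
  simp only [Matrix.mulVec, dotProduct, matH_apply, sub_mul, ite_mul, zero_mul, mul_sub,
    Finset.sum_sub_distrib, Finset.sum_ite_eq, Finset.mem_univ, if_true, ← Finset.sum_mul]
  ring

theorem sum_matH (i : Fin N) : ∑ j, G.matH i j = G.f i := by
  have := G.matH_mulVec_apply (fun _ => 1) i
  simpa [Matrix.mulVec, dotProduct] using this

/-- Unreached followers receive no edge from the leader or from reached followers. Hence `H` is
block triangular, and its block on the unreached followers has zero row sums and kills the all-ones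
vector. -/
theorem reachable_of_det_matH_ne_zero (h : G.matH.det ≠ 0) (a : Option (Fin N)) :
    Relation.ReflTransGen G.augmented.toDigraph.Adj none a := by
  classical
  set p : Fin N → Prop := fun i => Relation.ReflTransGen G.augmented.toDigraph.Adj none (some i)
    with hp
  suffices hall : ∀ i, p i by
    cases a with
    | none => exact .refl
    | some i => exact hall i
  by_contra! hex
  obtain ⟨i₀, hi₀⟩ := hex
  have hf (i : Fin N) (hi : ¬p i) : G.f i = 0 := by
    by_contra hne
    exact hi (Relation.ReflTransGen.single hne)
  have hadj (i : Fin N) (hi : ¬p i) (j : Fin N) (hj : p j) : G.matH i j = 0 := by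
    have h0 : G.followers.adj i j = 0 := by
      by_contra hne
      exact hi (Relation.ReflTransGen.tail hj hne)
    have hij : i ≠ j := fun e => hi (e ▸ hj)
    simp [matH_apply, h0, hij]
  refine h ?_
  rw [Matrix.twoBlockTriangular_det _ p hadj]
  refine mul_eq_zero_of_right _ (Matrix.exists_mulVec_eq_zero_iff.1
    ⟨fun _ => 1, Function.ne_iff.2 ⟨⟨i₀, hi₀⟩, one_ne_zero⟩, ?_⟩)
  ext ⟨i, hi⟩
  have hsum := Fintype.sum_subtype_add_sum_subtype p (G.matH i)
  rw [Finset.sum_eq_zero fun (j : {j // p j}) _ => hadj i hi j j.2, zero_add, sum_matH, hf i hi] at hsum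
  simpa [Matrix.mulVec, dotProduct, Matrix.toSquareBlockProp] using hsum

/-- If every follower can be reached from the leader, then the eigenvalues of `H` have positive
real part. -/
theorem re_pos_of_mem_spec_matH
    (hreach : ∀ a, Relation.ReflTransGen G.augmented.toDigraph.Adj none a)
    {h : ℂ} (hh : h ∈ spec G.matH) : 0 < h.re := by
  obtain ⟨w, hw0, hw⟩ := mem_spec_iff_exists_mulVec.1 hh
  by_contra! hre
  obtain ⟨i₁, hi₁⟩ := Function.ne_iff.1 hw0
  have : Nonempty (Fin N) := ⟨i₁⟩
  obtain ⟨i₀, hmax⟩ := Finite.exists_max fun i => ‖w i‖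
  have hm : 0 < ‖w i₀‖ := (norm_pos_iff.2 hi₁).trans_le (hmax i₁)
  have hrow (i : Fin N) : (((∑ j, |G.followers.adj i j|) + G.f i : ℝ) - h) * w i =
      ∑ j, (|G.followers.adj i j| : ℝ) * w j := by
    have := congrFun hw i
    simp only [Matrix.mulVec, dotProduct, Matrix.map_apply, matH_apply, sub_mul,
      Finset.sum_sub_distrib, apply_ite Complex.ofReal, Complex.ofReal_zero,
      ite_mul, zero_mul, Finset.sum_ite_eq, Finset.mem_univ, if_true, Pi.smul_apply, smul_eq_mul,
      Complex.coe_algebraMap, Complex.ofReal_sub] at this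
    rw [sub_mul, ← this]
    ring
  -- When `h.re ≤ 0`, diagonal dominance in a row of maximal modulus is forced to be an equality:
  -- there is no pinning, and all in-neighbours are maximal too.
  have hext (i : Fin N) (hi : ‖w i‖ = ‖w i₀‖) :
      G.f i = 0 ∧ ∀ j, G.followers.adj i j ≠ 0 → ‖w j‖ = ‖w i₀‖ := by
    have h1 : ((∑ j, |G.followers.adj i j|) + G.f i) * ‖w i₀‖ ≤
        ∑ j, |G.followers.adj i j| * ‖w j‖ := by
      calc _ ≤ ‖(((∑ j, |G.followers.adj i j|) + G.f i : ℝ) - h)‖ * ‖w i‖ := by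
            rw [hi]
            gcongr
            refine le_trans ?_ (Complex.re_le_norm _)
            rw [Complex.sub_re, Complex.ofReal_re]
            linarith
        _ = ‖∑ j, ((|G.followers.adj i j| : ℝ) : ℂ) * w j‖ := by rw [← norm_mul, hrow]
        _ ≤ ∑ j, ‖((|G.followers.adj i j| : ℝ) : ℂ) * w j‖ := norm_sum_le _ _
        _ = _ := by simp
    have hnn (j : Fin N) : 0 ≤ |G.followers.adj i j| * (‖w i₀‖ - ‖w j‖) :=
      mul_nonneg (abs_nonneg _) (sub_nonneg.2 (hmax j))
    have h2 : G.f i * ‖w i₀‖ + ∑ j, |G.followers.adj i j| * (‖w i₀‖ - ‖w j‖) ≤ 0 := by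
      simp only [mul_sub, Finset.sum_sub_distrib, ← Finset.sum_mul]
      linarith
    have h3 : 0 ≤ G.f i * ‖w i₀‖ := mul_nonneg (G.f_nonneg i) hm.le
    have h4 := Finset.sum_nonneg fun j (_ : j ∈ Finset.univ) => hnn j
    refine ⟨?_, fun j hj => ?_⟩
    · exact (mul_eq_zero.1 (by linarith : G.f i * ‖w i₀‖ = 0)).resolve_right hm.ne'
    · have h5 := (Finset.sum_eq_zero_iff_of_nonneg fun j _ => hnn j).1 (by linarith) j
        (Finset.mem_univ j)
      have h6 := (mul_eq_zero.1 h5).resolve_left (abs_ne_zero.2 hj)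
      linarith
  -- Maximality would propagate backwards along a path to a pinned follower, where `hext` fails.
  have hlt (a : Option (Fin N)) : ∀ i, a = some i → ‖w i‖ ≠ ‖w i₀‖ := by
    induction hreach a with
    | refl => simp
    | @tail b c _ hbc ih =>
      rintro i rfl hi
      cases b with
      | none => exact hbc (hext i hi).1
      | some j => exact ih j rfl ((hext i hi).2 j hbc)
  exact hlt _ i₀ rfl rfl

end AugmentedDigraph

end MORP

/-! ### The closed loop: observer design and output regulation -/

namespace MORP

theorem hasDerivWithinAt_mulVec {ι κ : Type*} [Fintype ι] [Fintype κ] (M : Matrix κ ι ℝ)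
    {v : ℝ → ι → ℝ} {v' : ι → ℝ} {s : Set ℝ} {t : ℝ} (h : HasDerivWithinAt v v' s t) :
    HasDerivWithinAt (fun t => M *ᵥ v t) (M *ᵥ v') s t :=
  (LinearMap.toContinuousLinearMap M.mulVecLin).hasFDerivAt.comp_hasDerivWithinAt t h

theorem tendsto_mulVec_zero {ι κ : Type*} [Fintype ι] (M : Matrix κ ι ℝ)
    {v : ℝ → ι → ℝ} (h : Tendsto v atTop (𝓝 0)) : Tendsto (fun t => M *ᵥ v t) atTop (𝓝 0) := by
  have hc : Continuous fun x : ι → ℝ => M *ᵥ x := continuous_const.matrix_mulVec continuous_id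
  simpa [Function.comp_def] using (hc.tendsto 0).comp h

namespace MAS

variable {N n₀ : ℕ} {n m p : Fin N → ℕ} (P : MAS N n₀ n m p) (G : AugmentedDigraph N)

/-- The system matrix of the distributed observer. -/
def observerMatrix (μ : ℝ) : Matrix (Fin N × Fin n₀) (Fin N × Fin n₀) ℝ :=
  (1 : Matrix (Fin N) (Fin N) ℝ) ⊗ₖ P.A₀ - μ • (G.matH ⊗ₖ (1 : Matrix (Fin n₀) (Fin n₀) ℝ))

theorem isHurwitz_closedLoopMatrix_iff (K : Gains N n₀ n m) :
    IsHurwitz (P.closedLoopMatrix G K) ↔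
      (∀ i, IsHurwitz (P.A i + P.B i * K.K₁ i)) ∧ IsHurwitz (P.observerMatrix G K.μ) := by
  simp only [IsHurwitz, closedLoopMatrix, spec_fromBlocks_zero₂₁, spec_blockDiagonal',
    Set.mem_union, Set.mem_iUnion, or_imp, forall_and, forall_exists_index, observerMatrix]
  rw [forall_comm]

theorem mem_spec_observerMatrix_iff {μ : ℝ} {z : ℂ} :
    z ∈ spec (P.observerMatrix G μ) ↔ ∃ a ∈ spec P.A₀, ∃ h ∈ spec (μ • G.matH), z = a - h := by
  rw [observerMatrix, ← Matrix.smul_kronecker, mem_spec_kronecker_sub_iff]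

/-- A null vector of `H` puts `0` in `spec (μ • H)`, whatever `μ` is, so every eigenvalue of `A₀`
survives in the observer. Since `n₀ ≠ 0`, there is one. -/
theorem det_matH_ne_zero_of_isHurwitz [NeZero n₀] (hA : spec P.A₀ ⊆ CRHP) {μ : ℝ}
    (h : IsHurwitz (P.observerMatrix G μ)) : G.matH.det ≠ 0 := by
  intro hdet
  obtain ⟨a, ha⟩ := spec_nonempty P.A₀
  obtain ⟨w, hw0, hw⟩ := Matrix.exists_mulVec_eq_zero_iff.2 hdet
  have h0 : (0 : ℂ) ∈ spec (μ • G.matH) := by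
    refine mem_spec_iff_exists_mulVec.2 ⟨fun i => (w i : ℂ), fun h => hw0 ?_, ?_⟩
    · ext i
      simpa using congrFun h i
    · ext i
      have := congrArg Complex.ofReal (congrFun hw i)
      simp only [Matrix.mulVec, dotProduct, Complex.ofReal_sum, Complex.ofReal_mul, Pi.zero_apply,
        Complex.ofReal_zero] at this
      simp [Matrix.mulVec, dotProduct, mul_assoc, ← Finset.mul_sum, this]
  have hneg := h a ((P.mem_spec_observerMatrix_iff G).2 ⟨a, ha, 0, h0, by simp⟩)
  exact absurd (hA ha) (not_le.2 hneg)

theorem exists_isHurwitz_observerMatrix (hH : ∀ h ∈ spec G.matH, 0 < h.re) :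
    ∃ μ : ℝ, IsHurwitz (P.observerMatrix G μ) := by
  have hfin : ((fun q : ℂ × ℂ => q.1.re / q.2.re) '' (spec P.A₀ ×ˢ spec G.matH)).Finite :=
    ((spec_finite _).prod (spec_finite _)).image _
  obtain ⟨b, hb⟩ := hfin.bddAbove
  -- Strictly above every ratio `a.re / h.re`, and positive so that division by `μ` maps `spec (μ •
  -- H)` into `spec H`.
  set μ := max b 0 + 1
  have hμ : 0 < μ := by positivity
  refine ⟨μ, fun z hz => ?_⟩
  obtain ⟨a, ha, h, hh, rfl⟩ := (P.mem_spec_observerMatrix_iff G).1 hz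
  obtain ⟨w, hw0, hw⟩ := mem_spec_iff_exists_mulVec.1 hh
  have hμc : (μ : ℂ) ≠ 0 := Complex.ofReal_ne_zero.2 hμ.ne'
  have hmem : h / μ ∈ spec G.matH := by
    refine mem_spec_iff_exists_mulVec.2 ⟨w, hw0, ?_⟩
    have hmap : (μ • G.matH).map (algebraMap ℝ ℂ) = (μ : ℂ) • G.matH.map (algebraMap ℝ ℂ) := by
      ext; simp
    rw [hmap, Matrix.smul_mulVec] at hw
    rw [div_eq_inv_mul, mul_smul, ← hw, inv_smul_smul₀ hμc]
  have hpos := hH _ hmem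
  have hle : a.re / (h / μ).re ≤ b := hb ⟨(a, h / μ), ⟨ha, hmem⟩, rfl⟩
  have hlt : a.re / (h / μ).re < μ := by
    have := le_max_left b 0
    linarith
  rw [div_lt_iff₀ hpos, Complex.div_ofReal_re, mul_div_cancel₀ _ hμ.ne'] at hlt
  simpa using hlt

theorem regulatorEquationsSolvable_of_solvesMORP (hA : spec P.A₀ ⊆ CRHP)
    {S : Matrix (Fin N) (Fin N) ℝ} {K : Gains N n₀ n m} (h : P.SolvesMORP G S K) :
    P.RegulatorEquationsSolvable S := by
  obtain ⟨hHur, hlim⟩ := h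
  have hHur := ((P.isHurwitz_closedLoopMatrix_iff G K).1 hHur).1
  choose X hX using fun i => exists_sylvester hA (hHur i) (P.B i * K.K₂ i + P.E i)
  have hX' (i : Fin N) :
      X i * P.A₀ = P.A i * X i + P.B i * (K.K₁ i * X i + K.K₂ i) + P.E i := by
    rw [hX, Matrix.add_mul, Matrix.mul_add, Matrix.mul_assoc]
    abel
  refine fun i => ⟨X i, K.K₁ i * X i + K.K₂ i, hX' i, Eq.symm ?_⟩
  refine eq_zero_of_tendsto_mulVec hA fun v hv => ?_
  -- With `η = v` all coupling terms vanish, and the Sylvester equation makes `x = X v` invariant.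
  have htraj : P.IsTrajectory G K v (fun i t => X i *ᵥ v t) (fun _ => v) := by
    refine ⟨fun t _ => (hv t).hasDerivWithinAt, fun i t _ => ?_, fun i t _ => ?_⟩
    · refine (hasDerivAt_mulVec (X i) (hv t)).hasDerivWithinAt.congr_deriv ?_
      rw [Matrix.mulVec_mulVec, hX']
      simp only [input, Matrix.add_mulVec, Matrix.mulVec_mulVec, Matrix.mulVec_add, Matrix.mul_add]
    · simpa using (hv t).hasDerivWithinAt
  refine (hlim _ _ _ htraj i).congr fun t => ?_
  simp only [trackingError, input, Matrix.add_mulVec, Matrix.mulVec_mulVec, Matrix.mulVec_add,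
    Matrix.mul_add, Matrix.smul_mulVec]

/-- The coupling depends only on differences, so the stacked error `η - v` obeys the autonomous
observer system. -/
theorem tendsto_observerError {K : Gains N n₀ n m} (hobs : IsHurwitz (P.observerMatrix G K.μ))
    {v : ℝ → Fin n₀ → ℝ} {x : ∀ i, ℝ → Fin (n i) → ℝ} {η : Fin N → ℝ → Fin n₀ → ℝ}
    (h : P.IsTrajectory G K v x η) (i : Fin N) :
    Tendsto (fun t => η i t - v t) atTop (𝓝 0) := by
  have hlim : Tendsto (fun t (q : Fin N × Fin n₀) => η q.1 t q.2 - v t q.2) atTop (𝓝 0) := by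
    refine hobs.tendsto_zero (g := 0) (fun t ht => ?_) tendsto_const_nhds
    rw [hasDerivWithinAt_pi]
    rintro ⟨j, k⟩
    refine ((hasDerivWithinAt_pi.1 (h.observer j t ht) k).sub
      (hasDerivWithinAt_pi.1 (h.exosystem t ht) k)).congr_deriv ?_
    rw [observerMatrix, Matrix.sub_mulVec, Matrix.smul_mulVec]
    simp only [Pi.add_apply, Pi.sub_apply, Pi.smul_apply, one_kronecker_mulVec_apply,
      kronecker_one_mulVec_apply, AugmentedDigraph.matH_mulVec_apply, Pi.zero_apply, smul_eq_mul,
      Finset.sum_apply]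
    have hs : (fun l => η j t l - v t l) = η j t - v t := rfl
    rw [hs, Matrix.mulVec_sub, Pi.sub_apply]
    simp only [sub_sub_sub_cancel_right]
    ring
  rw [tendsto_pi_nhds] at hlim ⊢
  exact fun k => hlim (i, k)

theorem solvesMORP_of_regulatorEquations {S : Matrix (Fin N) (Fin N) ℝ} {K : Gains N n₀ n m}
    (hfb : ∀ i, IsHurwitz (P.A i + P.B i * K.K₁ i)) (hobs : IsHurwitz (P.observerMatrix G K.μ))
    {X : ∀ i, Matrix (Fin (n i)) (Fin n₀) ℝ} {U : ∀ i, Matrix (Fin (m i)) (Fin n₀) ℝ}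
    (hX : ∀ i, X i * P.A₀ = P.A i * X i + P.B i * U i + P.E i)
    (hU : ∀ i, 0 = P.C i * X i + P.D i * U i + P.G i + S i i • P.F i)
    (hK : ∀ i, K.K₂ i = U i - K.K₁ i * X i) : P.SolvesMORP G S K := by
  refine ⟨(P.isHurwitz_closedLoopMatrix_iff G K).2 ⟨hfb, hobs⟩, fun v x η h i => ?_⟩
  have hη := P.tendsto_observerError G hobs h i
  -- By the choice of `K₂`, `ξ = x - X v` satisfies `ξ' = (A + B K₁) ξ + B K₂ (η - v)`.
  have hξ : Tendsto (fun t => x i t - X i *ᵥ v t) atTop (𝓝 0) := by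
    refine (hfb i).tendsto_zero (g := fun t => (P.B i * K.K₂ i) *ᵥ (η i t - v t))
      (fun t ht => ?_) (tendsto_mulVec_zero _ hη)
    refine ((h.follower i t ht).sub
      (hasDerivWithinAt_mulVec (X i) (h.exosystem t ht))).congr_deriv ?_
    rw [Matrix.mulVec_mulVec, hX, hK]
    simp only [input, hK, Matrix.add_mulVec, Matrix.sub_mulVec, Matrix.mulVec_mulVec,
      Matrix.mulVec_add, Matrix.mulVec_sub, Matrix.mul_sub, Matrix.add_mul, Matrix.mul_assoc]
    abel
  have hsum := (tendsto_mulVec_zero (P.C i + P.D i * K.K₁ i) hξ).add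
    (tendsto_mulVec_zero (P.D i * K.K₂ i) hη)
  rw [add_zero] at hsum
  refine hsum.congr fun t => ?_
  have hz : (P.C i * X i + P.D i * U i + P.G i + S i i • P.F i) *ᵥ v t = 0 := by
    rw [← hU, Matrix.zero_mulVec]
  -- The error differs from the decaying combination exactly by the regulator residual applied to
  -- `v`, which is zero.
  rw [← sub_eq_zero, ← neg_eq_zero, ← hz]
  simp only [trackingError, input, hK, Matrix.add_mulVec, Matrix.sub_mulVec, Matrix.mulVec_mulVec,
    Matrix.mulVec_add, Matrix.mulVec_sub, Matrix.mul_sub, Matrix.add_mul, Matrix.mul_assoc,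
    Matrix.smul_mulVec]
  abel

end MAS

end MORP

theorem theorem1 {N n₀ : ℕ} {n m p : Fin N → ℕ} (hn₀ : 0 < n₀)
    (P : MORP.MAS N n₀ n m p) (G : MORP.AugmentedDigraph N)
    (k : ℕ) (S : Matrix (Fin N) (Fin N) ℝ) (hS : MORP.IsPartitionTransformation k S) :
    (MORP.spec P.A₀ ⊂ MORP.CRHP → P.MORPSolvable G S →
      P.Stabilizable ∧ P.RegulatorEquationsSolvable S ∧ G.augmented.HasDirectedSpanningTree) ∧
    (P.Stabilizable ∧ P.RegulatorEquationsSolvable S ∧ G.augmented.HasDirectedSpanningTree →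
      P.MORPSolvable G S) := by
  refine ⟨fun hA ⟨K, hK⟩ => ?_, fun ⟨hstab, hreg, htree⟩ => ?_⟩
  · have : NeZero n₀ := ⟨hn₀.ne'⟩
    obtain ⟨hfb, hobs⟩ := (P.isHurwitz_closedLoopMatrix_iff G K).1 hK.1
    exact ⟨fun i => ⟨K.K₁ i, hfb i⟩, P.regulatorEquationsSolvable_of_solvesMORP G hA.1 hK,
      MORP.SignedDigraph.hasDirectedSpanningTree_of_reachable
        (G.reachable_of_det_matH_ne_zero (P.det_matH_ne_zero_of_isHurwitz G hA.1 hobs))⟩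
  · choose K₁ hK₁ using hstab
    choose X U hX hU using hreg
    obtain ⟨μ, hμ⟩ := P.exists_isHurwitz_observerMatrix G fun _ =>
      G.re_pos_of_mem_spec_matH (G.reachable_of_hasDirectedSpanningTree htree)
    exact ⟨⟨μ, K₁, fun i => U i - K₁ i * X i⟩,
      P.solvesMORP_of_regulatorEquations G hK₁ hμ hX hU fun _ => rfl⟩
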